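/- Let $R$ be a commutative noetherian ring with unit together with a surjective ring homomorphism $\Phi\colon R\to\mathbb Z_3$, and put $I=\ker\Phi$. A quasimodule is a commutative Moufang loop $Q(+)$ (a loop with neutral element $0$ satisfying $(x+x)+(a+b)=(x+a)+(x+b)$) with a scalar multiplication $R\times Q\to Q$ satisfying $r(x+y)=rx+ry$, $(r+s)x=rx+sx$, $(rs)x=r(sx)$, $1x=x$, $0x=0$ for all $r,s\in R$, and $rx+(y+z)=(rx+y)+z$ for all $r\in I$ and $x,y,z\in Q$. A submodule of $Q$ is a subquasimodule whose addition is associative; the socle of $Q$ is the subquasimodule generated by all minimal nonzero submodules of $Q$; and $Q$ is cocyclic if its socle is a nonzero simple submodule that meets every nonzero subquasimodule nontrivially. An $R$-module is regarded as an associative quasimodule. A ternary algebra is an $R$-module $A$ with an $R$-trilinear map $\tau\colon A^3\to A$ such that $I\tau=0$, $\tau(x,x,y)=0$, $\tau(\tau(x,y,z),u,v)=0$ and $\tau(u,v,\tau(x,y,z))=0$. Put $\bar\tau(x,y,z)=\tau(x,y,z)+\tau(y,z,x)+\tau(z,x,y)$, and let $q(A)$ be the quasimodule on the set $A$ with loop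 operation $x*y=x+y+\tau(x,y,x-y)$ and the scalar multiplication of the module $A$. For an $R$-module $M$ let $K(M)=\{x\in M : Ix=0\}$, and define ${}^{0}K(M)=0$, ${}^{\alpha+1}K(M)/{}^{\alpha}K(M)=K(M/{}^{\alpha}K(M))$, ${}^{\alpha}K(M)=\bigcup_{\beta<\alpha}{}^{\beta}K(M)$ for limit $\alpha$; $M$ is $\widehat K$-torsion if $M=\bigcup_\alpha {}^{\alpha}K(M)$. **Theorem.** A finite quasimodule $Q$ is non-associative and cocyclic if and only if there is a ternary algebra $A$ such that $Q=q(A)$, $\bar\tau\neq 0$, and the underlying $R$-module of $A$ is cocyclic. Moreover, for every such $A$, the underlying module of $A$ is $\widehat K$-torsion and cannot be generated by fewer than $3$ elements. -/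

import Mathlib

universe u v

/-! Throughout, `R` is a commutative ring with a ring homomorphism `F : R →+* ZMod 3`,
and the ideal `I` of the theory is `RingHom.ker F`. -/

/-- A quasimodule: a commutative Moufang loop (a loop with `(x + x) + (a + b) = (x + a) + (x + b)`)
written additively, with a scalar multiplication by `R` satisfying the unitary module equations,
and such that `(r x) + (y + z) = ((r x) + y) + z` for all `r` in the kernel of `F`. -/
@[ext]
structure Quasimodule {R : Type*} [CommRing R] (F : R →+* ZMod 3) (Q : Type*) where
  add : Q → Q → Q
  zero : Q
  smul : R → Q → Q
  existsUnique_right : ∀ a b : Q, ∃! x : Q, add a x = b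
  existsUnique_left : ∀ a b : Q, ∃! y : Q, add y a = b
  zero_add : ∀ x : Q, add zero x = x
  add_zero : ∀ x : Q, add x zero = x
  moufang : ∀ x a b : Q, add (add x x) (add a b) = add (add x a) (add x b)
  smul_add : ∀ (r : R) (x y : Q), smul r (add x y) = add (smul r x) (smul r y)
  add_smul : ∀ (r s : R) (x : Q), smul (r + s) x = add (smul r x) (smul s x)
  mul_smul : ∀ (r s : R) (x : Q), smul (r * s) x = smul r (smul s x)
  one_smul : ∀ x : Q, smul 1 x = x
  zero_smul : ∀ x : Q, smul 0 x = zero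
  ker_assoc : ∀ r ∈ RingHom.ker F, ∀ x y z : Q,
    add (smul r x) (add y z) = add (add (smul r x) y) z

namespace Quasimodule

variable {R : Type*} [CommRing R] {F : R →+* ZMod 3} {Q : Type*}

/-- `Q` is associative, i.e. it is a module. -/
def IsAssociative (X : Quasimodule F Q) : Prop :=
  ∀ x y z : Q, X.add (X.add x y) z = X.add x (X.add y z)

/-- `P` is (the underlying set of) a subquasimodule. Closure under the divisions of the loop is
automatic, see `IsSubquasimodule.mem_of_add_mem`. -/
structure IsSubquasimodule (X : Quasimodule F Q) (P : Set Q) : Prop where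
  zero_mem : X.zero ∈ P
  add_mem : ∀ x ∈ P, ∀ y ∈ P, X.add x y ∈ P
  smul_mem : ∀ (r : R), ∀ x ∈ P, X.smul r x ∈ P

theorem add_neg_add (X : Quasimodule F Q) (x b : Q) :
    X.add x (X.add (X.smul (-1) x) b) = b := by
  have h0 : X.add x (X.smul (-1) x) = X.zero := by
    have h := X.add_smul 1 (-1) x
    rw [add_neg_cancel, X.zero_smul, X.one_smul] at h
    exact h.symm
  have h1 : ∀ c, X.add (X.add x x) c = X.add x (X.add x c) := fun c => by
    have h := X.moufang x X.zero c
    rwa [X.zero_add, X.add_zero] at h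
  have h2 := X.moufang x (X.smul (-1) x) b
  rw [h0, X.zero_add, h1] at h2
  exact (X.existsUnique_right x (X.add x b)).unique h2 rfl

theorem IsSubquasimodule.mem_of_add_mem {X : Quasimodule F Q} {P : Set Q}
    (hP : X.IsSubquasimodule P) {a x : Q} (ha : a ∈ P) (h : X.add a x ∈ P) : x ∈ P := by
  have h1 : X.add a (X.add (X.smul (-1) a) (X.add a x)) = X.add a x := X.add_neg_add a _
  have h2 := (X.existsUnique_right a (X.add a x)).unique h1 rfl
  rw [← h2]
  exact hP.add_mem _ (hP.smul_mem _ _ ha) _ h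

/-- A submodule of a quasimodule is a subquasimodule that is a module, i.e. associative. -/
def IsSubmodule (X : Quasimodule F Q) (P : Set Q) : Prop :=
  X.IsSubquasimodule P ∧
    ∀ x ∈ P, ∀ y ∈ P, ∀ z ∈ P, X.add (X.add x y) z = X.add x (X.add y z)

/-- `P` is a minimal nonzero submodule; equivalently, a submodule that is simple as a module. -/
def IsMinimalSubmodule (X : Quasimodule F Q) (P : Set Q) : Prop :=
  X.IsSubmodule P ∧ P ≠ {X.zero} ∧
    ∀ P' : Set Q, X.IsSubmodule P' → P' ⊆ P → P' = {X.zero} ∨ P' = P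

/-- The socle: the subquasimodule generated by all minimal submodules. -/
def socle (X : Quasimodule F Q) : Set Q :=
  ⋂₀ {P : Set Q | X.IsSubquasimodule P ∧ ∀ M : Set Q, X.IsMinimalSubmodule M → M ⊆ P}

/-- `P` is essential: it meets every nonzero subquasimodule nontrivially. -/
def IsEssential (X : Quasimodule F Q) (P : Set Q) : Prop :=
  ∀ P' : Set Q, X.IsSubquasimodule P' → P' ≠ {X.zero} → P ∩ P' ≠ {X.zero}

/-- A quasimodule is cocyclic if its socle is a nonzero essential simple submodule. -/
def IsCocyclic (X : Quasimodule F Q) : Prop :=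
  X.IsMinimalSubmodule X.socle ∧ X.IsEssential X.socle

/-- An `R`-module, regarded as an (associative) quasimodule. -/
def ofModule (F : R →+* ZMod 3) (M : Type*) [AddCommGroup M] [Module R M] : Quasimodule F M where
  add x y := x + y
  zero := 0
  smul r x := r • x
  existsUnique_right a b := ⟨b - a, by simp, fun y hy => by simp [← hy]⟩
  existsUnique_left a b := ⟨b - a, by simp, fun y hy => by simp [← hy]⟩
  zero_add := _root_.zero_add
  add_zero := _root_.add_zero
  moufang x a b := add_add_add_comm x x a b
  smul_add := _root_.smul_add
  add_smul := _root_.add_smul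
  mul_smul := SemigroupAction.mul_smul
  one_smul := _root_.one_smul R
  zero_smul := _root_.zero_smul R
  ker_assoc r _ x y z := (add_assoc (r • x) y z).symm

end Quasimodule

/-- A ternary algebra: a module with a trilinear map `τ` such that `I τ = 0`, `τ (x, x, y) = 0`,
`τ (τ (x, y, z), u, v) = 0` and `τ (u, v, τ (x, y, z)) = 0`, where `I = ker F`. -/
structure TernaryAlgebra {R : Type*} [CommRing R] (F : R →+* ZMod 3)
    (A : Type*) [AddCommGroup A] [Module R A] where
  τ : A →ₗ[R] A →ₗ[R] A →ₗ[R] A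
  ker_smul : ∀ r ∈ RingHom.ker F, ∀ x y z : A, r • τ x y z = 0
  self_self : ∀ x y : A, τ x x y = 0
  τ_left : ∀ x y z u v : A, τ (τ x y z) u v = 0
  τ_right : ∀ x y z u v : A, τ u v (τ x y z) = 0

namespace TernaryAlgebra

variable {R : Type*} [CommRing R] {F : R →+* ZMod 3} {A : Type*} [AddCommGroup A] [Module R A]

/-- The map `τ̄ (x, y, z) = τ (x, y, z) + τ (y, z, x) + τ (z, x, y)`. -/
def tauBar (T : TernaryAlgebra F A) (x y z : A) : A :=
  T.τ x y z + T.τ y z x + T.τ z x y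

theorem swap (T : TernaryAlgebra F A) (x y z : A) : T.τ y x z = -T.τ x y z := by
  have h := T.self_self (x + y) z
  simp only [map_add, LinearMap.add_apply, T.self_self, zero_add, add_zero] at h
  exact eq_neg_of_add_eq_zero_left h

theorem τ_mid (T : TernaryAlgebra F A) (x y z u v : A) : T.τ u (T.τ x y z) v = 0 := by
  rw [T.swap, T.τ_left, neg_zero]

theorem three (T : TernaryAlgebra F A) (x y z : A) :
    T.τ x y z + T.τ x y z + T.τ x y z = 0 := by
  have h := T.ker_smul 3 (by rw [RingHom.mem_ker, map_ofNat]; rfl) x y z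
  have h3 : (3 : R) = 1 + 1 + 1 := by norm_num
  rwa [h3, add_smul, add_smul, one_smul] at h

/-- The operation `x * y = x + y + τ (x, y, x - y)`. -/
def op (T : TernaryAlgebra F A) (x y : A) : A := x + y + T.τ x y (x - y)

theorem op_comm (T : TernaryAlgebra F A) (x y : A) : T.op x y = T.op y x := by
  simp only [op, T.swap x y, map_sub]
  abel

theorem op_eq_iff (T : TernaryAlgebra F A) (x y b : A) :
    T.op x y = b ↔ y = b - x + T.τ x b x + T.τ x b b := by
  constructor
  · rintro rfl
    have h := T.three x y x
    simp only [op, map_add, map_sub, LinearMap.add_apply, LinearMap.sub_apply, T.self_self,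
      T.τ_mid, T.τ_right, zero_add, add_zero, sub_zero]
    rw [← sub_eq_zero, ← neg_eq_zero, ← h]
    abel
  · rintro rfl
    have h := T.three x b x
    simp only [op, map_add, map_sub, LinearMap.add_apply, LinearMap.sub_apply, T.self_self,
      T.τ_mid, T.τ_right, add_zero, sub_zero]
    rw [← sub_eq_zero, ← h]
    abel

theorem smul_cube (T : TernaryAlgebra F A) (r : R) (x y z : A) :
    r • r • r • T.τ x y z = r • T.τ x y z := by
  have hr : r * (r * r) - r ∈ RingHom.ker F := by
    rw [RingHom.mem_ker, map_sub, map_mul, map_mul]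
    generalize F r = a
    revert a
    decide
  have h := T.ker_smul _ hr x y z
  rw [sub_smul, mul_smul, mul_smul] at h
  exact sub_eq_zero.mp h

/-- The quasimodule `q(A) = A(*, r x)` of a ternary algebra `A`: the loop operation is
`x * y = x + y + τ (x, y, x - y)` and the scalar multiplication is that of the module `A`. -/
def q (T : TernaryAlgebra F A) : Quasimodule F A where
  add := T.op
  zero := 0
  smul r x := r • x
  existsUnique_right a b := by simp only [T.op_eq_iff, existsUnique_eq]
  existsUnique_left a b := by simp only [T.op_comm _ a, T.op_eq_iff, existsUnique_eq]
  zero_add x := by simp [op]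
  add_zero x := by simp [op]
  moufang x a b := by
    have h1 := T.three x a x
    have h2 := T.three x a b
    have h3 := T.three x b x
    have h4 := T.three x b a
    simp only [op, map_add, map_sub, LinearMap.add_apply, LinearMap.sub_apply, T.self_self,
      T.τ_mid, T.τ_right, T.τ_left, zero_add, add_zero, sub_zero, T.swap x a]
    rw [← sub_eq_zero]
    have h := congrArg₂ (· - ·) (congrArg₂ (· + ·) h1 h3) (congrArg₂ (· + ·) h2 h4)
    simp only [add_zero, sub_zero] at h
    rw [← h]
    abel
  smul_add r x y := by
    simp only [op, map_smul, map_sub, smul_add, smul_sub, LinearMap.smul_apply, T.smul_cube]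
  add_smul r s x := by
    simp [op, add_smul, T.self_self]
  mul_smul r s x := mul_smul r s x
  one_smul x := one_smul R x
  zero_smul x := zero_smul R x
  ker_assoc r hr x y z := by
    simp only [op, map_add, map_sub, map_smul, LinearMap.add_apply, LinearMap.sub_apply,
      LinearMap.smul_apply, T.τ_mid, T.τ_right, T.ker_smul r hr, zero_add, add_zero,
      sub_zero]
    abel_nf

end TernaryAlgebra

/-- The greatest primitive submodule `K(M) = {x | I x = 0}` of a module `M`, `I = ker F`. -/
def primitivePart {R : Type*} [CommRing R] (F : R →+* ZMod 3)
    (M : Type*) [AddCommGroup M] [Module R M] : Submodule R M :=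
  Submodule.torsionBySet R M (RingHom.ker F : Set R)

/-- The transfinite iterates of `K`: `K^0 M = 0`, `K^(α+1) M / K^α M = K(M / K^α M)`, and unions
at limit ordinals. -/
noncomputable def primitiveSeq {R : Type*} [CommRing R] (F : R →+* ZMod 3)
    (M : Type*) [AddCommGroup M] [Module R M] (α : Ordinal) : Submodule R M :=
  Ordinal.limitRecOn (motive := fun _ => Submodule R M) α ⊥
    (fun _ N => (primitivePart F (M ⧸ N)).comap N.mkQ)
    (fun _ _ N => ⨆ β, ⨆ h, N β h)

/-- `M` is `K̂`-torsion: the union `K̂(M)` of all `K^α M` is `M`. -/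
def IsKHatTorsion {R : Type*} [CommRing R] (F : R →+* ZMod 3)
    (M : Type v) [AddCommGroup M] [Module R M] : Prop :=
  ⨆ α : Ordinal.{v}, primitiveSeq F M α = ⊤

/-! ### Loop identities and an elementwise criterion for cocyclicity -/

namespace Quasimodule

variable {R : Type*} [CommRing R] {F : R →+* ZMod 3} {Q : Type*} (X : Quasimodule F Q)

/-! A quasimodule is cocyclic exactly when some `s ≠ 0` is a scalar multiple of every nonzero
element (`isCocyclic_iff`). This involves only scalars and zero, so `A` and `q(A)` are cocyclic
together; since the associator of `q(A)` is `τ̄` (`op_op`), one direction follows.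

Conversely, the axiom on `I = ker F` makes `I` kill every associator. In the non-associative
cocyclic case all associators therefore lie in the copy of `ZMod 3` spanned by `s`, and the Moufang
law forces this copy to be central (`exists_centralEmbedding`). The associator becomes an
alternating trilinear form `a` with values in `ZMod 3`. The crux is to write `a` as the cyclic sum
of a trilinear `t` antisymmetric in its first two variables (`exists_cyclic_sum`). Then `t(x,y,y) -
t(x,y,x)` is a cochain whose coboundary cancels the associator: adding it to the loop sum gives a
module (`addition_assoc`), and `t`, read in the central copy, is the required `τ`.

For the last claims, `τ̄` is alternating, so it vanishes on a module with two generators; and a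
nonzero value of `τ̄` is killed by `I`, which by cocyclicity and finiteness makes a power of `I`
annihilate `A`. -/

theorem add_left_cancel {a x y : Q} (h : X.add a x = X.add a y) : x = y :=
  (X.existsUnique_right a (X.add a y)).unique h rfl

theorem double_add (x c : Q) : X.add (X.add x x) c = X.add x (X.add x c) := by
  have h := X.moufang x X.zero c
  rwa [X.zero_add, X.add_zero] at h

/-- Commutativity is hidden in the Moufang law: with `y = x + a` and `b = 0` it reads `x + (x + a) =
(x + a) + x`, by left alternativity. -/
theorem add_comm (x y : Q) : X.add x y = X.add y x := by
  obtain ⟨a, rfl, -⟩ := X.existsUnique_right x y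
  have h := X.moufang x a X.zero
  rw [X.add_zero, X.add_zero, X.double_add] at h
  exact h

theorem smul_zero (r : R) : X.smul r X.zero = X.zero := by
  have h := X.mul_smul r 0 X.zero
  rwa [mul_zero, X.zero_smul, eq_comm] at h

/-- The inner mappings `z ↦ (x + y) \ (x + (y + z))` are additive. -/
theorem inner_map_add {x y a b a' b' c' : Q}
    (ha : X.add (X.add x y) a' = X.add x (X.add y a))
    (hb : X.add (X.add x y) b' = X.add x (X.add y b))
    (hc : X.add (X.add x y) c' = X.add x (X.add y (X.add a b))) :
    c' = X.add a' b' := by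
  -- Three uses of the Moufang law. The right side depends only on `p + q`, so the pairs `(a, b)`
  -- and `(a + b, 0)` can be compared.
  have key : ∀ {p q p' q' : Q}, X.add (X.add x y) p' = X.add x (X.add y p) →
      X.add (X.add x y) q' = X.add x (X.add y q) →
      X.add (X.add (X.add x y) (X.add x y)) (X.add p' q') =
        X.add (X.add x x) (X.add (X.add y y) (X.add p q)) := by
    intro p q p' q' hp hq
    rw [X.moufang, hp, hq, ← X.moufang, ← X.moufang]
  have h0 : X.add (X.add x y) X.zero = X.add x (X.add y X.zero) := by
    rw [X.add_zero, X.add_zero]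
  have h1 := key hc h0
  rw [X.add_zero, X.add_zero, ← key ha hb] at h1
  exact X.add_left_cancel h1

/-- The cyclic submodule generated by an element. -/
def cyclic (x : Q) : Set Q := Set.range fun r => X.smul r x

theorem self_mem_cyclic (x : Q) : x ∈ X.cyclic x := ⟨1, X.one_smul x⟩

theorem cyclic_subset {P : Set Q} (hP : X.IsSubquasimodule P) {x : Q} (hx : x ∈ P) :
    X.cyclic x ⊆ P := by
  rintro _ ⟨r, rfl⟩
  exact hP.smul_mem r x hx

theorem isSubmodule_cyclic (x : Q) : X.IsSubmodule (X.cyclic x) := by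
  refine ⟨⟨⟨0, X.zero_smul x⟩, ?_, ?_⟩, ?_⟩
  · rintro _ ⟨r, rfl⟩ _ ⟨s, rfl⟩
    exact ⟨r + s, X.add_smul r s x⟩
  · rintro r _ ⟨s, rfl⟩
    exact ⟨r * s, X.mul_smul r s x⟩
  · rintro _ ⟨r, rfl⟩ _ ⟨s, rfl⟩ _ ⟨t, rfl⟩
    simp only [← X.add_smul, add_assoc]

theorem exists_ne_zero {P : Set Q} (hP : X.IsSubquasimodule P) (h : P ≠ {X.zero}) :
    ∃ x ∈ P, x ≠ X.zero := by
  by_contra! h'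
  exact h (Set.Subset.antisymm h' (Set.singleton_subset_iff.mpr hP.zero_mem))

theorem IsSubquasimodule.inter {X : Quasimodule F Q} {P P' : Set Q} (hP : X.IsSubquasimodule P)
    (hP' : X.IsSubquasimodule P') : X.IsSubquasimodule (P ∩ P') :=
  ⟨⟨hP.zero_mem, hP'.zero_mem⟩,
    fun x hx y hy => ⟨hP.add_mem x hx.1 y hy.1, hP'.add_mem x hx.2 y hy.2⟩,
    fun r x hx => ⟨hP.smul_mem r x hx.1, hP'.smul_mem r x hx.2⟩⟩

/-- A quasimodule is cocyclic if and only if some nonzero element lies in all nonzero cyclic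
submodules. -/
theorem isCocyclic_iff :
    X.IsCocyclic ↔ ∃ s, s ≠ X.zero ∧ ∀ x, x ≠ X.zero → ∃ r, X.smul r x = s := by
  constructor
  · rintro ⟨⟨hS, hS0, hmin⟩, hess⟩
    obtain ⟨s, hs, hs0⟩ := X.exists_ne_zero hS.1 hS0
    refine ⟨s, hs0, fun x hx => ?_⟩
    have hc := X.isSubmodule_cyclic x
    have hne : X.cyclic x ≠ {X.zero} := fun h => hx (by
      have := X.self_mem_cyclic x
      rwa [h] at this)
    have hsub : X.IsSubmodule (X.socle ∩ X.cyclic x) :=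
      ⟨hS.1.inter hc.1, fun a ha b hb c hc => hS.2 a ha.1 b hb.1 c hc.1⟩
    rcases hmin _ hsub Set.inter_subset_left with h | h
    · exact absurd h (hess _ hc.1 hne)
    · rw [← h] at hs
      exact hs.2
  · rintro ⟨s, hs0, hs⟩
    -- The cyclic submodule of `s` is the least nonzero subquasimodule, hence the only minimal
    -- submodule and the socle.
    have hle : ∀ P, X.IsSubquasimodule P → P ≠ {X.zero} → X.cyclic s ⊆ P := by
      intro P hP hne
      obtain ⟨x, hx, hx0⟩ := X.exists_ne_zero hP hne
      obtain ⟨r, rfl⟩ := hs x hx0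
      exact X.cyclic_subset hP (hP.smul_mem r x hx)
    have hne : X.cyclic s ≠ {X.zero} := fun h => hs0 (by
      have := X.self_mem_cyclic s
      rwa [h] at this)
    have hmin : X.IsMinimalSubmodule (X.cyclic s) := by
      refine ⟨X.isSubmodule_cyclic s, hne, fun P hP hPs => ?_⟩
      by_cases h : P = {X.zero}
      · exact Or.inl h
      · exact Or.inr (hPs.antisymm (hle P hP.1 h))
    have hsoc : X.socle = X.cyclic s := by
      refine Set.Subset.antisymm (Set.sInter_subset_of_mem ⟨hmin.1.1, fun M hM => ?_⟩)
        (Set.subset_sInter fun P hP => hP.2 _ hmin)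
      rcases hM.2.2 _ hmin.1 (hle M hM.1.1 hM.2.1) with h | h
      · exact absurd h hne
      · exact h.ge
    refine ⟨hsoc ▸ hmin, fun P hP hP0 => ?_⟩
    rw [hsoc, Set.inter_eq_left.mpr (hle P hP hP0)]
    exact hne

/-! ### Associators and the central copy of `ZMod 3` -/

/-- A copy of `ZMod 3` inside the centre of a quasimodule. -/
structure CentralEmbedding (X : Quasimodule F Q) where
  toFun : ZMod 3 → Q
  injective : Function.Injective toFun
  map_zero : toFun 0 = X.zero
  map_add : ∀ c d, toFun (c + d) = X.add (toFun c) (toFun d)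
  smul : ∀ r c, X.smul r (toFun c) = toFun (F r * c)
  central : ∀ x y c, X.add x (X.add y (toFun c)) = X.add (X.add x y) (toFun c)

section Primitive

variable {X} {s : Q}

theorem smul_congr_of_primitive (hs : ∀ r ∈ RingHom.ker F, X.smul r s = X.zero) {r r' : R}
    (h : F r = F r') : X.smul r s = X.smul r' s := by
  have h1 := X.add_smul (r - r') r' s
  rwa [sub_add_cancel, hs (r - r') (by rw [RingHom.mem_ker, map_sub, h, sub_self]),
    X.zero_add] at h1

theorem smul_val (F : R →+* ZMod 3) (c : ZMod 3) : F ((c.val : ℕ) : R) = c := by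
  rw [map_natCast, ZMod.natCast_zmod_val]

theorem primitive_smul_smul (hs : ∀ r ∈ RingHom.ker F, X.smul r s = X.zero) (r : R)
    (c : ZMod 3) :
    X.smul r (X.smul (c.val : R) s) = X.smul (((F r * c).val : ℕ) : R) s := by
  rw [← X.mul_smul]
  exact smul_congr_of_primitive hs (by rw [map_mul, smul_val, smul_val])

theorem primitive_add (hs : ∀ r ∈ RingHom.ker F, X.smul r s = X.zero) (c d : ZMod 3) :
    X.smul ((c + d).val : R) s = X.add (X.smul (c.val : R) s) (X.smul (d.val : R) s) := by
  rw [← X.add_smul]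
  exact smul_congr_of_primitive hs (by rw [_root_.map_add, smul_val, smul_val, smul_val])

theorem primitive_injective (hs : ∀ r ∈ RingHom.ker F, X.smul r s = X.zero)
    (hs0 : s ≠ X.zero) : Function.Injective fun c : ZMod 3 => X.smul (c.val : R) s := by
  intro c d h
  by_contra hcd
  have h1 := primitive_add hs (c - d) d
  rw [sub_add_cancel] at h1
  have h2 : X.smul ((c - d).val : R) s = X.zero := by
    apply X.add_left_cancel (a := X.smul (d.val : R) s)
    rw [X.add_comm, ← h1, X.add_zero]
    exact h
  have h3 := primitive_smul_smul hs (((c - d)⁻¹.val : ℕ) : R) (c - d)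
  rw [h2, X.smul_zero, smul_val, inv_mul_cancel₀ (sub_ne_zero.mpr hcd)] at h3
  apply hs0
  rw [h3, ← smul_congr_of_primitive hs (r := 1) (by rw [smul_val, map_one]), X.one_smul]

/-- Multiples of `s` can be merged before `s` is known to be central. In `ZMod 3` any `c`, `d`
satisfy `c = 0`, `d = 0`, `d = c` or `d = -c`; the last two cases are the alternative law and the
inverse property. -/
theorem add_primitive_add (hs : ∀ r ∈ RingHom.ker F, X.smul r s = X.zero) (q : Q)
    (c d : ZMod 3) :
    X.add (X.add q (X.smul (c.val : R) s)) (X.smul (d.val : R) s) =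
      X.add q (X.smul ((c + d).val : R) s) := by
  have h0 : X.smul ((0 : ZMod 3).val : R) s = X.zero := by simp [X.zero_smul]
  have hneg : ∀ c : ZMod 3, X.smul ((-c).val : R) s = X.smul (-1) (X.smul (c.val : R) s) := by
    intro c
    rw [primitive_smul_smul hs, map_neg, map_one, neg_one_mul]
  have hinv : ∀ c : ZMod 3, X.add (X.add q (X.smul (c.val : R) s)) (X.smul ((-c).val : R) s) =
      X.add q (X.smul ((c + -c).val : R) s) := by
    intro c
    rw [add_neg_cancel, h0, X.add_zero, X.add_comm _ (X.smul _ _), X.add_comm q]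
    have := X.add_neg_add (X.smul ((-c).val : R) s) q
    rwa [← hneg, neg_neg] at this
  have hdouble : ∀ c : ZMod 3, X.add (X.add q (X.smul (c.val : R) s)) (X.smul (c.val : R) s) =
      X.add q (X.smul ((c + c).val : R) s) := by
    intro c
    rw [primitive_add hs, X.add_comm q (X.add _ _), X.double_add, X.add_comm _ (X.smul _ _),
      X.add_comm q]
  have hcases : ∀ c d : ZMod 3, c = 0 ∨ d = 0 ∨ d = c ∨ d = -c := by decide
  rcases hcases c d with rfl | rfl | rfl | rfl
  · rw [h0, X.add_zero, _root_.zero_add]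
  · rw [h0, X.add_zero, _root_.add_zero]
  · exact hdouble d
  · exact hinv c

/-- If all associators are multiples of a primitive element, then that element is central. -/
theorem primitive_central (hs : ∀ r ∈ RingHom.ker F, X.smul r s = X.zero) (hs0 : s ≠ X.zero)
    (hassoc : ∀ x y z, ∃ c : ZMod 3,
      X.add (X.add x y) z = X.add (X.add x (X.add y z)) (X.smul (c.val : R) s))
    (x y : Q) (c : ZMod 3) :
    X.add x (X.add y (X.smul (c.val : R) s)) = X.add (X.add x y) (X.smul (c.val : R) s) := by
  have h0 : X.smul ((0 : ZMod 3).val : R) s = X.zero := by simp [X.zero_smul]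
  have h1 : X.smul ((1 : ZMod 3).val : R) s = s := by
    rw [← smul_congr_of_primitive hs (r := 1) (by rw [smul_val, map_one]), X.one_smul]
  -- Here `e = 0` would give `v + s = v` by cancellation.
  have hex : ∀ u v, ∃ e : ZMod 3, e ≠ 0 ∧
      X.add u (X.add v s) = X.add (X.add u v) (X.smul (e.val : R) s) := by
    intro u v
    obtain ⟨d, hd⟩ := hassoc u v s
    have he : X.add u (X.add v s) = X.add (X.add u v) (X.smul ((1 + -d).val : R) s) := by
      rw [← add_primitive_add hs, h1, hd, add_primitive_add hs, add_neg_cancel, h0, X.add_zero]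
    refine ⟨1 + -d, fun h => hs0 ?_, he⟩
    rw [h, h0, X.add_zero] at he
    exact X.add_left_cancel ((X.add_left_cancel he).trans (X.add_zero v).symm)
  choose e he0 he using hex
  -- Expand `(s + s) + (u + v) = (u + s) + (v + s)`. Two nonzero elements of `ZMod 3` with sum 2 are
  -- both 1, so every defect `e` is trivial.
  have hsum : ∀ u v, e v u + e (X.add u s) v = 1 + 1 := by
    intro u v
    have h := X.moufang s u v
    rw [X.add_comm s u, X.add_comm s v, he (X.add u s) v, X.add_comm (X.add u s) v, he v u,
      add_primitive_add hs, X.add_comm v u, X.add_comm _ (X.add u v)] at h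
    have h2 := X.add_left_cancel h
    nth_rewrite 1 2 [← h1] at h2
    rw [← primitive_add hs] at h2
    exact (primitive_injective hs hs0 h2).symm
  have hone : ∀ a b : ZMod 3, a ≠ 0 → b ≠ 0 → a + b = 1 + 1 → a = 1 := by decide
  have hc1 : ∀ u v, X.add u (X.add v s) = X.add (X.add u v) s := by
    intro u v
    rw [he u v, hone _ _ (he0 _ _) (he0 _ _) (hsum v u), h1]
  have hcases : ∀ c : ZMod 3, c = 0 ∨ c = 1 ∨ c = 1 + 1 := by decide
  rcases hcases c with rfl | rfl | rfl
  · rw [h0, X.add_zero, X.add_zero]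
  · rw [h1, hc1]
  · rw [← add_primitive_add hs, ← add_primitive_add hs, h1, hc1, hc1]

end Primitive

/-- In a non-associative cocyclic quasimodule all associators lie in a central copy of `ZMod 3`. -/
theorem exists_centralEmbedding (hna : ¬ X.IsAssociative) (hX : X.IsCocyclic) :
    ∃ C : X.CentralEmbedding, ∀ x y z, ∃ c,
      X.add (X.add x y) z = X.add (X.add x (X.add y z)) (C.toFun c) := by
  obtain ⟨s, hs0, hs⟩ := X.isCocyclic_iff.mp hX
  -- For `r` in `I`, multiplication by `r` turns both bracketings into the same element, so `r`
  -- kills the associator `d`.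
  have hd : ∀ x y z, ∃ d, X.add (X.add x y) z = X.add (X.add x (X.add y z)) d ∧
      ∀ r ∈ RingHom.ker F, X.smul r d = X.zero := by
    intro x y z
    obtain ⟨d, hd, -⟩ := X.existsUnique_right (X.add x (X.add y z)) (X.add (X.add x y) z)
    refine ⟨d, hd.symm, fun r hr => ?_⟩
    have h := congrArg (X.smul r) hd
    have e : X.smul r (X.add (X.add x y) z) = X.smul r (X.add x (X.add y z)) := by
      simp only [X.smul_add, X.ker_assoc r hr]
    rw [e, X.smul_add] at h
    exact X.add_left_cancel (h.trans (X.add_zero _).symm)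
  have hprim : ∀ r ∈ RingHom.ker F, X.smul r s = X.zero := by
    simp only [IsAssociative, not_forall] at hna
    obtain ⟨x, y, z, hne⟩ := hna
    obtain ⟨d, hd, hdr⟩ := hd x y z
    have hd0 : d ≠ X.zero := by
      rintro rfl
      exact hne (by rw [hd, X.add_zero])
    obtain ⟨t, rfl⟩ := hs d hd0
    intro r hr
    rw [← X.mul_smul, hdr _ (Ideal.mul_mem_right t _ hr)]
  -- If `d ≠ 0`, then `s = t d` with `F t ≠ 0`, and `d` is recovered by inverting `F t`.
  have hmul : ∀ d, (∀ r ∈ RingHom.ker F, X.smul r d = X.zero) →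
      ∃ c : ZMod 3, X.smul (c.val : R) s = d := by
    intro d hdr
    by_cases hd0 : d = X.zero
    · exact ⟨0, by simp [X.zero_smul, hd0]⟩
    obtain ⟨t, ht⟩ := hs d hd0
    have ht0 : F t ≠ 0 := fun h => hs0 (by rw [← ht, hdr t h])
    refine ⟨(F t)⁻¹, ?_⟩
    rw [← ht, ← X.mul_smul, smul_congr_of_primitive hdr (r' := 1), X.one_smul]
    rw [map_mul, smul_val, inv_mul_cancel₀ ht0, map_one]
  have hassoc : ∀ x y z, ∃ c : ZMod 3,
      X.add (X.add x y) z = X.add (X.add x (X.add y z)) (X.smul (c.val : R) s) := by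
    intro x y z
    obtain ⟨d, hd, hdr⟩ := hd x y z
    obtain ⟨c, rfl⟩ := hmul d hdr
    exact ⟨c, hd⟩
  exact ⟨{  toFun := fun c => X.smul (c.val : R) s
            injective := primitive_injective hprim hs0
            map_zero := by simp [X.zero_smul]
            map_add := primitive_add hprim
            smul := primitive_smul_smul hprim
            central := primitive_central hprim hs0 hassoc }, hassoc⟩

end Quasimodule

/-! ### The associator as an alternating trilinear form -/

namespace Quasimodule

variable {R : Type*} [CommRing R] {F : R →+* ZMod 3} {Q : Type*} {X : Quasimodule F Q}

namespace CentralEmbedding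

variable (C : X.CentralEmbedding)

/-- Translation by a central element. -/
def shift (x : Q) (c : ZMod 3) : Q := X.add x (C.toFun c)

theorem shift_zero (x : Q) : C.shift x 0 = x := by rw [shift, C.map_zero, X.add_zero]

theorem zero_shift (c : ZMod 3) : C.shift X.zero c = C.toFun c := by rw [shift, X.zero_add]

theorem shift_shift (x : Q) (c d : ZMod 3) : C.shift (C.shift x c) d = C.shift x (c + d) := by
  rw [shift, shift, shift, C.map_add, C.central]

theorem add_shift (x y : Q) (c : ZMod 3) : X.add x (C.shift y c) = C.shift (X.add x y) c :=
  C.central x y c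

theorem shift_add (x y : Q) (c : ZMod 3) : X.add (C.shift x c) y = C.shift (X.add x y) c := by
  rw [X.add_comm, C.add_shift, X.add_comm]

theorem smul_shift (r : R) (x : Q) (c : ZMod 3) :
    X.smul r (C.shift x c) = C.shift (X.smul r x) (F r * c) := by
  rw [shift, X.smul_add, C.smul, shift]

theorem shift_left_cancel {x : Q} {c d : ZMod 3} (h : C.shift x c = C.shift x d) : c = d :=
  C.injective (X.add_left_cancel h)

/-- The linear forms on `Q` that vanish on the central copy of `ZMod 3`. -/
def forms : Submodule (ZMod 3) (Q → ZMod 3) where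
  carrier := {h | (∀ x y, h (X.add x y) = h x + h y) ∧ (∀ r x, h (X.smul r x) = F r * h x) ∧
    ∀ c, h (C.toFun c) = 0}
  zero_mem' := by simp
  add_mem' := by
    rintro f g ⟨hf, hf', hf''⟩ ⟨hg, hg', hg''⟩
    refine ⟨fun x y => ?_, fun r x => ?_, fun c => ?_⟩
    · simp only [Pi.add_apply, hf, hg]
      abel
    · simp only [Pi.add_apply, hf', hg', mul_add]
    · simp only [Pi.add_apply, hf'', hg'', _root_.add_zero]
  smul_mem' := by
    rintro a f ⟨hf, hf', hf''⟩
    refine ⟨fun x y => ?_, fun r x => ?_, fun c => ?_⟩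
    · simp only [Pi.smul_apply, hf, _root_.smul_add]
    · simp only [Pi.smul_apply, hf', smul_eq_mul, mul_left_comm]
    · simp only [Pi.smul_apply, hf'', _root_.smul_zero]

/-- A function of three variables that is a linear form in each variable. -/
structure IsTrilinear (f : Q → Q → Q → ZMod 3) : Prop where
  left : ∀ y z, (fun x => f x y z) ∈ C.forms
  mid : ∀ x z, (fun y => f x y z) ∈ C.forms
  right : ∀ x y, (fun z => f x y z) ∈ C.forms

section Associator

variable {C} {a : Q → Q → Q → ZMod 3}
  (ha : ∀ x y z, X.add (X.add x y) z = C.shift (X.add x (X.add y z)) (a x y z))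
include ha

theorem associator_reverse (x y z : Q) : a z y x = -a x y z := by
  apply eq_neg_of_add_eq_zero_left
  apply C.shift_left_cancel (x := X.add z (X.add y x))
  rw [← C.shift_shift, ← ha, X.add_comm (X.add z y), X.add_comm z y, ← ha,
    X.add_comm (X.add x y), X.add_comm x y, C.shift_zero]

/-- Rebracketing and commuting three times leads from `(x + y) + z` back to itself, collecting the
three associators. -/
theorem associator_cyclic_sum (x y z : Q) : a x y z + a y z x + a z x y = 0 := by
  apply C.shift_left_cancel (x := X.add (X.add x y) z)
  rw [C.shift_zero]
  nth_rewrite 2 [ha x y z]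
  rw [X.add_comm x (X.add y z), ha y z x, X.add_comm y (X.add z x), ha z x y,
    C.shift_shift, C.shift_shift, X.add_comm z (X.add x y)]
  congr 1
  ring

/-- The inner mapping for `x`, `y` sends `z` to `z` shifted by `-a x y z`, and inner mappings are
additive. -/
theorem associator_add_right (x y z w : Q) : a x y (X.add z w) = a x y z + a x y w := by
  have key : ∀ z, X.add (X.add x y) (C.shift z (-a x y z)) = X.add x (X.add y z) := by
    intro z
    rw [C.add_shift, ha, C.shift_shift, add_neg_cancel, C.shift_zero]
  have h := X.inner_map_add (key z) (key w) (key (X.add z w))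
  rw [C.add_shift, C.shift_add, C.shift_shift] at h
  have h1 := C.shift_left_cancel h
  rw [← neg_inj, h1, neg_add]

theorem associator_add_left (x y z w : Q) : a (X.add x w) y z = a x y z + a w y z := by
  rw [associator_reverse ha z y, associator_add_right ha, neg_add, ← associator_reverse ha,
    ← associator_reverse ha]

theorem associator_self_left (x y : Q) : a x x y = 0 := by
  apply C.shift_left_cancel (x := X.add x (X.add x y))
  rw [← ha, C.shift_zero, X.double_add]

theorem associator_add_mid (x y z w : Q) : a x (X.add y w) z = a x y z + a x w z := by
  have h := associator_cyclic_sum ha x (X.add y w) z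
  have h1 := associator_cyclic_sum ha x y z
  have h2 := associator_cyclic_sum ha x w z
  rw [associator_add_left ha, associator_add_right ha] at h
  linear_combination h - h1 - h2

theorem associator_swap (x y z : Q) : a y x z = -a x y z := by
  have h := associator_self_left ha (X.add x y) z
  rw [associator_add_left ha, associator_add_mid ha, associator_add_mid ha,
    associator_self_left ha, associator_self_left ha, _root_.zero_add, _root_.add_zero] at h
  exact eq_neg_of_add_eq_zero_right h

theorem associator_rotate (x y z : Q) : a y z x = a x y z := by
  rw [associator_swap ha, associator_reverse ha x y z, neg_neg]

theorem associator_natCast_smul (n : ℕ) (x y z : Q) : a (X.smul (n : R) x) y z = n * a x y z := by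
  induction n with
  | zero =>
    have h := associator_add_left ha X.zero y z X.zero
    rw [X.zero_add] at h
    rw [Nat.cast_zero, X.zero_smul, Nat.cast_zero, zero_mul]
    exact left_eq_add.mp h
  | succ n ih =>
    rw [Nat.cast_succ, X.add_smul, associator_add_left ha, ih, X.one_smul, Nat.cast_succ]
    ring

/-- Modulo `I`, `r` is the natural number `(F r).val`: the part in `I` associates with everything,
and natural multiples follow from additivity. -/
theorem associator_smul (r : R) (x y z : Q) : a (X.smul r x) y z = F r * a x y z := by
  have hr : r - ((F r).val : R) ∈ RingHom.ker F := by
    rw [RingHom.mem_ker, map_sub, smul_val, sub_self]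
  have h0 : a (X.smul (r - ((F r).val : R)) x) y z = 0 := by
    apply C.shift_left_cancel (x := X.add (X.smul (r - ((F r).val : R)) x) (X.add y z))
    rw [← ha, C.shift_zero, X.ker_assoc _ hr]
  have h := associator_add_left ha (X.smul (r - ((F r).val : R)) x) y z (X.smul ((F r).val : R) x)
  rw [← X.add_smul, sub_add_cancel, h0, _root_.zero_add, associator_natCast_smul ha,
    ZMod.natCast_zmod_val] at h
  exact h

theorem associator_central (c : ZMod 3) (y z : Q) : a (C.toFun c) y z = 0 := by
  apply C.shift_left_cancel (x := X.add (C.toFun c) (X.add y z))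
  rw [← ha, C.shift_zero, ← C.zero_shift, C.shift_add, C.shift_add, C.shift_add, X.zero_add,
    X.zero_add]

theorem isTrilinear_associator : C.IsTrilinear a := by
  have h : ∀ y z, (fun x => a x y z) ∈ C.forms := fun y z =>
    ⟨fun x w => associator_add_left ha x y z w, fun r x => associator_smul ha r x y z,
      fun c => associator_central ha c y z⟩
  refine ⟨h, fun x z => ?_, fun x y => ?_⟩
  · simp only [← associator_rotate ha x]
    exact h z x
  · simp only [associator_rotate ha _ x y]
    exact h x y

end Associator

/-! ### Splitting the alternating form as a cyclic sum -/

theorem sum_mem_forms {ι : Type*} {C : X.CentralEmbedding} (s : Finset ι) (f : ι → Q → ZMod 3)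
    (hf : ∀ i ∈ s, f i ∈ C.forms) : (fun x => ∑ i ∈ s, f i x) ∈ C.forms := by
  have := Submodule.sum_mem _ hf
  convert this using 1
  ext x
  simp

theorem sum_rotate {n : ℕ} (g : Fin n → Fin n → Fin n → ZMod 3) :
    ∑ i, ∑ j, ∑ k, g i j k = ∑ i, ∑ j, ∑ k, g j k i := by
  rw [Finset.sum_congr rfl fun j _ => Finset.sum_comm, Finset.sum_comm]

/-- A trilinear function is a combination of products of linear forms. -/
theorem IsTrilinear.exists_coordinates [Finite Q] {C : X.CentralEmbedding}
    {a : Q → Q → Q → ZMod 3} (ha : C.IsTrilinear a) :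
    ∃ (n : ℕ) (h : Fin n → Q → ZMod 3) (e : Fin n → Q), (∀ i, h i ∈ C.forms) ∧
      ∀ x y z, a x y z = ∑ i, h i x * a (e i) y z := by
  -- The image of `p` is a finite-dimensional space over `ZMod 3`; the coordinates of `p x` in a
  -- basis `p (e i)` are the linear forms sought.
  let p : Q → Q × Q → ZMod 3 := fun x w => a x w.1 w.2
  have padd : ∀ x y, p (X.add x y) = p x + p y := fun x y =>
    funext fun w => (ha.left w.1 w.2).1 x y
  have psmul : ∀ r x, p (X.smul r x) = F r • p x := fun r x =>
    funext fun w => (ha.left w.1 w.2).2.1 r x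
  have pcentral : ∀ c, p (C.toFun c) = 0 := fun c => funext fun w => (ha.left w.1 w.2).2.2 c
  let V : Submodule (ZMod 3) (Q × Q → ZMod 3) :=
    { carrier := Set.range p
      zero_mem' := ⟨C.toFun 0, pcentral 0⟩
      add_mem' := by
        rintro _ _ ⟨x, rfl⟩ ⟨y, rfl⟩
        exact ⟨X.add x y, padd x y⟩
      smul_mem' := by
        rintro c _ ⟨x, rfl⟩
        exact ⟨X.smul (c.val : R) x, by rw [psmul, smul_val]⟩ }
  let P : Q → V := fun x => ⟨p x, x, rfl⟩
  let b := Module.finBasis (ZMod 3) V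
  have hb : ∀ i, ∃ x, P x = b i := by
    intro i
    obtain ⟨x, hx⟩ := (b i).2
    exact ⟨x, Subtype.ext hx⟩
  choose e he using hb
  refine ⟨_, fun i x => b.repr (P x) i, e, fun i => ⟨fun x y => ?_, fun r x => ?_, fun c => ?_⟩,
    fun x y z => ?_⟩
  · have : P (X.add x y) = P x + P y := Subtype.ext (padd x y)
    simp only [this, _root_.map_add, Finsupp.add_apply]
  · have : P (X.smul r x) = F r • P x := Subtype.ext (psmul r x)
    simp only [this, map_smul, Finsupp.smul_apply, smul_eq_mul]
  · have : P (C.toFun c) = 0 := Subtype.ext (pcentral c)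
    simp only [this, _root_.map_zero, Finsupp.coe_zero, Pi.zero_apply]
  · have h1 : (P x : Q × Q → ZMod 3) (y, z) =
        ((∑ i, b.repr (P x) i • b i : V) : Q × Q → ZMod 3) (y, z) := by rw [b.sum_repr]
    rw [AddSubmonoidClass.coe_finsetSum, Finset.sum_apply] at h1
    refine h1.trans (Finset.sum_congr rfl fun i _ => ?_)
    rw [← he]
    rfl

/-- An alternating trilinear function is the cyclic sum of a trilinear function which is
antisymmetric in the first two variables. -/
theorem IsTrilinear.exists_cyclic_sum [Finite Q] {C : X.CentralEmbedding}
    {a : Q → Q → Q → ZMod 3} (ha : C.IsTrilinear a) (h0 : ∀ x y, a x x y = 0)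
    (hswap : ∀ x y z, a y x z = -a x y z) (hrot : ∀ x y z, a y z x = a x y z) :
    ∃ t, C.IsTrilinear t ∧ (∀ x y z, t y x z = -t x y z) ∧
      ∀ x y z, t x y z + t y z x + t z x y = a x y z := by
  obtain ⟨n, h, e, hh, hexp⟩ := ha.exists_coordinates
  -- A multiple of `a` cannot serve, since `a` is rotation invariant and `3 a = 0`. Instead keep a
  -- coefficient only when its last index is the largest: this is symmetric in `i`, `j` and holds
  -- for exactly one rotation of three distinct indices. Repeated indices contribute 0.
  let c : Fin n → Fin n → Fin n → ZMod 3 := fun i j k =>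
    if i < k ∧ j < k then a (e i) (e j) (e k) else 0
  have hc : ∀ i j k, c j i k = -c i j k := by
    intro i j k
    simp only [c, and_comm (a := j < k), hswap (e i) (e j)]
    split_ifs <;> simp
  have hcsum : ∀ i j k, c i j k + c j k i + c k i j = a (e i) (e j) (e k) := by
    intro i j k
    have h1 : ∀ x y, a x y y = 0 := fun x y => by rw [← hrot, h0]
    have h2 : ∀ x y, a x y x = 0 := fun x y => by rw [hrot, h0]
    have r1 : a (e j) (e k) (e i) = a (e i) (e j) (e k) := hrot _ _ _
    have r2 : a (e k) (e i) (e j) = a (e i) (e j) (e k) := (hrot _ _ _).symm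
    simp only [c, r1, r2]
    by_cases hij : i = j
    · simp [hij, h0]
    by_cases hjk : j = k
    · simp [hjk, h1]
    by_cases hik : i = k
    · simp [hik, h2]
    split_ifs <;> first | (simp; done) | (exfalso; omega)
  have hexp3 : ∀ x y z, a x y z =
      ∑ i, ∑ j, ∑ k, h i x * (h j y * (h k z * a (e i) (e j) (e k))) := by
    intro x y z
    rw [hexp]
    refine Finset.sum_congr rfl fun i _ => ?_
    rw [← hrot, hexp, Finset.mul_sum]
    refine Finset.sum_congr rfl fun j _ => ?_
    rw [← hrot, hexp, Finset.mul_sum, Finset.mul_sum]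
    refine Finset.sum_congr rfl fun k _ => ?_
    rw [← hrot]
  refine ⟨fun x y z => ∑ i, ∑ j, ∑ k, h i x * (h j y * (h k z * c i j k)), ⟨?_, ?_, ?_⟩, ?_, ?_⟩
  · intro y z
    refine sum_mem_forms _ _ fun i _ => sum_mem_forms _ _ fun j _ => sum_mem_forms _ _ fun k _ => ?_
    convert C.forms.smul_mem (h j y * (h k z * c i j k)) (hh i) using 1
    ext x
    simp only [Pi.smul_apply, smul_eq_mul]
    ring
  · intro x z
    refine sum_mem_forms _ _ fun i _ => sum_mem_forms _ _ fun j _ => sum_mem_forms _ _ fun k _ => ?_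
    convert C.forms.smul_mem (h i x * (h k z * c i j k)) (hh j) using 1
    ext x
    simp only [Pi.smul_apply, smul_eq_mul]
    ring
  · intro x y
    refine sum_mem_forms _ _ fun i _ => sum_mem_forms _ _ fun j _ => sum_mem_forms _ _ fun k _ => ?_
    convert C.forms.smul_mem (h i x * (h j y * c i j k)) (hh k) using 1
    ext x
    simp only [Pi.smul_apply, smul_eq_mul]
    ring
  · intro x y z
    beta_reduce
    rw [Finset.sum_comm, ← Finset.sum_neg_distrib]
    refine Finset.sum_congr rfl fun i _ => ?_
    rw [← Finset.sum_neg_distrib]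
    refine Finset.sum_congr rfl fun j _ => ?_
    rw [← Finset.sum_neg_distrib]
    refine Finset.sum_congr rfl fun k _ => ?_
    rw [hc]
    ring
  · intro x y z
    beta_reduce
    rw [hexp3, sum_rotate (fun i j k => h i y * (h j z * (h k x * c i j k))),
      ← sum_rotate (fun j k i => h i z * (h j x * (h k y * c i j k)))]
    simp only [← Finset.sum_add_distrib, ← hcsum]
    refine Finset.sum_congr rfl fun i _ => Finset.sum_congr rfl fun j _ =>
      Finset.sum_congr rfl fun k _ => ?_
    ring

end CentralEmbedding
end Quasimodule

/-! ### Recovering the module and the ternary algebra from the loop -/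

namespace Quasimodule

variable {R : Type*} [CommRing R] {F : R →+* ZMod 3} {Q : Type*} {X : Quasimodule F Q}

/-- A trilinear function on a quasimodule, antisymmetric in the first two variables, whose cyclic
sum is the associator. -/
structure AssociatorSplitting (C : X.CentralEmbedding) where
  toFun : Q → Q → Q → ZMod 3
  isTrilinear : C.IsTrilinear toFun
  swap : ∀ x y z, toFun y x z = -toFun x y z
  assoc : ∀ x y z, X.add (X.add x y) z =
    C.shift (X.add x (X.add y z)) (toFun x y z + toFun y z x + toFun z x y)

namespace AssociatorSplitting

variable {C : X.CentralEmbedding} (t : AssociatorSplitting C)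

/-- The correction term between the loop addition and the module addition. -/
def twist (x y : Q) : ZMod 3 := t.toFun x y y - t.toFun x y x

/-- The addition of the module underlying the ternary algebra. -/
def addition (x y : Q) : Q := C.shift (X.add x y) (t.twist x y)

theorem self_self (x z : Q) : t.toFun x x z = 0 := by
  have h : ∀ c : ZMod 3, c = -c → c = 0 := by decide
  exact h _ (t.swap x x z)

theorem form_shift {h : Q → ZMod 3} (hh : h ∈ C.forms) (x : Q) (c : ZMod 3) :
    h (C.shift x c) = h x := by
  rw [CentralEmbedding.shift, hh.1, hh.2.2, _root_.add_zero]

/-- The two additions differ by a central shift, which forms ignore; hence `t` stays trilinear for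
the new addition. -/
theorem form_addition {h : Q → ZMod 3} (hh : h ∈ C.forms) (x y : Q) :
    h (t.addition x y) = h x + h y := by
  rw [addition, form_shift hh, hh.1]

theorem left_addition (x y z w : Q) :
    t.toFun (t.addition x w) y z = t.toFun x y z + t.toFun w y z :=
  t.form_addition (t.isTrilinear.left y z) x w

theorem mid_addition (x y z w : Q) :
    t.toFun x (t.addition y w) z = t.toFun x y z + t.toFun x w z :=
  t.form_addition (t.isTrilinear.mid x z) y w

theorem right_addition (x y z w : Q) :
    t.toFun x y (t.addition z w) = t.toFun x y z + t.toFun x y w :=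
  t.form_addition (t.isTrilinear.right x y) z w

theorem left_smul (r : R) (x y z : Q) : t.toFun (X.smul r x) y z = F r * t.toFun x y z :=
  (t.isTrilinear.left y z).2.1 r x

theorem mid_smul (r : R) (x y z : Q) : t.toFun x (X.smul r y) z = F r * t.toFun x y z :=
  (t.isTrilinear.mid x z).2.1 r y

theorem right_smul (r : R) (x y z : Q) : t.toFun x y (X.smul r z) = F r * t.toFun x y z :=
  (t.isTrilinear.right x y).2.1 r z

theorem left_central (c : ZMod 3) (y z : Q) : t.toFun (C.toFun c) y z = 0 :=
  (t.isTrilinear.left y z).2.2 c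

theorem mid_central (x : Q) (c : ZMod 3) (z : Q) : t.toFun x (C.toFun c) z = 0 :=
  (t.isTrilinear.mid x z).2.2 c

theorem right_central (x y : Q) (c : ZMod 3) : t.toFun x y (C.toFun c) = 0 :=
  (t.isTrilinear.right x y).2.2 c

theorem addition_comm (x y : Q) : t.addition x y = t.addition y x := by
  rw [addition, addition, X.add_comm x y, twist, twist, t.swap x y, t.swap x y, neg_sub_neg]

/-- The coboundary of `twist` is minus the cyclic sum of `t`, up to a multiple of 3, so it cancels
the associator. -/
theorem addition_assoc (x y z : Q) :
    t.addition (t.addition x y) z = t.addition x (t.addition y z) := by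
  have h1 : t.twist (t.addition x y) z =
      t.toFun x z z + t.toFun y z z - (t.toFun x z x + t.toFun x z y +
        (t.toFun y z x + t.toFun y z y)) := by
    simp only [twist, left_addition, right_addition]
    ring
  have h2 : t.twist x (t.addition y z) =
      t.toFun x y y + t.toFun x y z + (t.toFun x z y + t.toFun x z z) -
        (t.toFun x y x + t.toFun x z x) := by
    simp only [twist, mid_addition, right_addition]
    ring
  have h3 : t.toFun x y z + t.toFun y z x + t.toFun z x y + t.twist x y +
      t.twist (t.addition x y) z =
      t.twist y z + t.twist x (t.addition y z) := by
    have h : (3 : ZMod 3) = 0 := rfl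
    rw [h1, h2, twist, twist, t.swap x z y]
    linear_combination (-t.toFun x z y) * h
  have h4 : X.add (t.addition x y) z = C.shift (X.add (X.add x y) z) (t.twist x y) :=
    C.shift_add _ _ _
  have h5 : X.add x (t.addition y z) = C.shift (X.add x (X.add y z)) (t.twist y z) :=
    C.add_shift _ _ _
  change C.shift (X.add (t.addition x y) z) _ = _
  rw [h4, t.assoc, C.shift_shift, C.shift_shift, ← _root_.add_assoc, h3,
    ← C.shift_shift, ← h5]
  rfl

theorem zero_addition (x : Q) : t.addition X.zero x = x := by
  rw [addition, twist, ← C.map_zero, t.left_central, t.left_central, sub_zero, C.shift_zero,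
    C.map_zero, X.zero_add]

/-- The twist is cubic, so it scales by `(F r)^3`, which equals `F r` in `ZMod 3`. -/
theorem smul_addition (r : R) (x y : Q) :
    X.smul r (t.addition x y) = t.addition (X.smul r x) (X.smul r y) := by
  have h : ∀ a : ZMod 3, a = a * (a * a) := by decide
  rw [addition, addition, C.smul_shift, X.smul_add, twist, twist]
  simp only [left_smul, mid_smul, right_smul]
  congr 1
  linear_combination (t.toFun x y y - t.toFun x y x) * h (F r)

theorem addition_smul (r s : R) (x : Q) :
    X.smul (r + s) x = t.addition (X.smul r x) (X.smul s x) := by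
  rw [addition, twist]
  simp only [left_smul, mid_smul, t.self_self, mul_zero, sub_zero, C.shift_zero, X.add_smul]

theorem addition_central (x : Q) (c : ZMod 3) : t.addition x (C.toFun c) = C.shift x c := by
  rw [addition, twist, t.mid_central, t.mid_central, sub_zero, C.shift_zero, CentralEmbedding.shift]

/-- The additive group underlying the ternary algebra. -/
abbrev addCommGroup : AddCommGroup Q where
  add := t.addition
  zero := X.zero
  neg := X.smul (-1)
  add_assoc := t.addition_assoc
  zero_add := t.zero_addition
  add_zero x := (t.addition_comm x X.zero).trans (t.zero_addition x)
  neg_add_cancel x := by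
    have h := t.addition_smul (-1) 1 x
    rw [neg_add_cancel, X.zero_smul, X.one_smul] at h
    exact h.symm
  add_comm := t.addition_comm
  nsmul := @nsmulRec Q ⟨X.zero⟩ ⟨t.addition⟩
  zsmul := @zsmulRec Q ⟨X.zero⟩ ⟨t.addition⟩ ⟨X.smul (-1)⟩ (@nsmulRec Q ⟨X.zero⟩ ⟨t.addition⟩)

/-- The module underlying the ternary algebra. -/
abbrev module : @Module R Q _ t.addCommGroup.toAddCommMonoid :=
  letI := t.addCommGroup
  { smul := X.smul
    one_smul := X.one_smul
    mul_smul := X.mul_smul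
    smul_zero := X.smul_zero
    smul_add := t.smul_addition
    add_smul := t.addition_smul
    zero_smul := X.zero_smul }

/-- The ternary algebra. -/
def ternaryAlgebra : @TernaryAlgebra R _ F Q t.addCommGroup t.module :=
  letI := t.addCommGroup
  letI := t.module
  have hadd : ∀ c d, C.toFun (c + d) = C.toFun c + C.toFun d := fun c d =>
    (C.map_add c d).trans (t.addition_central (C.toFun c) d).symm
  have hsmul : ∀ (r : R) c, C.toFun (F r * c) = r • C.toFun c := fun r c => (C.smul r c).symm
  { τ :=
      { toFun := fun x => LinearMap.mk₂ R (fun y z => C.toFun (t.toFun x y z))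
          (fun y w z => (congrArg C.toFun (t.mid_addition x y z w)).trans (hadd _ _))
          (fun r y z => (congrArg C.toFun (t.mid_smul r x y z)).trans (hsmul _ _))
          (fun y z w => (congrArg C.toFun (t.right_addition x y z w)).trans (hadd _ _))
          (fun r y z => (congrArg C.toFun (t.right_smul r x y z)).trans (hsmul _ _))
        map_add' := fun x w => LinearMap.ext₂ fun y z =>
          (congrArg C.toFun (t.left_addition x y z w)).trans (hadd _ _)
        map_smul' := fun r x => LinearMap.ext₂ fun y z =>
          (congrArg C.toFun (t.left_smul r x y z)).trans (hsmul _ _) }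
    ker_smul := fun r hr x y z => by
      have h := C.smul r (t.toFun x y z)
      rw [RingHom.mem_ker.mp hr, zero_mul, C.map_zero] at h
      exact h
    self_self := fun x y => (congrArg C.toFun (t.self_self x y)).trans C.map_zero
    τ_left := fun x y z u v => (congrArg C.toFun (t.left_central _ u v)).trans C.map_zero
    τ_right := fun x y z u v => (congrArg C.toFun (t.right_central u v _)).trans C.map_zero }

/-- In the new module `τ (x, y, x - y)` is minus the twist, so the operation of `q` undoes the
correction. -/
theorem eq_q : X = @TernaryAlgebra.q R _ F Q t.addCommGroup t.module t.ternaryAlgebra := by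
  let := t.addCommGroup
  let := t.module
  refine Quasimodule.ext ?_ rfl rfl
  funext x y
  change X.add x y = t.addition (t.addition x y)
    (C.toFun (t.toFun x y (x - y)))
  have h : t.toFun x y (x - y) = -t.twist x y := by
    have h1 : t.toFun x y (x + X.smul (-1) y) = _ := t.right_addition x y x (X.smul (-1) y)
    rw [sub_eq_add_neg]
    refine h1.trans ?_
    rw [t.right_smul, twist, map_neg, map_one]
    ring
  rw [h, t.addition_central, addition, C.shift_shift, add_neg_cancel, C.shift_zero]

end AssociatorSplitting

theorem exists_associatorSplitting [Finite Q] (hna : ¬ X.IsAssociative) (hX : X.IsCocyclic) :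
    ∃ C : X.CentralEmbedding, Nonempty (AssociatorSplitting C) := by
  obtain ⟨C, hC⟩ := X.exists_centralEmbedding hna hX
  choose a ha using hC
  replace ha : ∀ x y z, X.add (X.add x y) z = C.shift (X.add x (X.add y z)) (a x y z) := ha
  obtain ⟨t, ht, hswap, hsum⟩ := (C.isTrilinear_associator ha).exists_cyclic_sum
    (C.associator_self_left ha) (C.associator_swap ha) (C.associator_rotate ha)
  exact ⟨C, ⟨⟨t, ht, hswap, fun x y z => by rw [hsum, ha]⟩⟩⟩

end Quasimodule

/-! ### Associator, cocyclicity and generators for `q(A)` -/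

namespace TernaryAlgebra

variable {R : Type*} [CommRing R] {F : R →+* ZMod 3} {A : Type*} [AddCommGroup A] [Module R A]
  (T : TernaryAlgebra F A)

/-- Nested values of `τ` vanish, and the remaining cubic terms differ by `3 τ (x, z, y) = 0`. -/
theorem op_op (x y z : A) : T.op (T.op x y) z = T.op x (T.op y z) + T.tauBar x y z := by
  have h := T.three x z y
  rw [← sub_eq_zero, ← h, tauBar, T.swap x z y]
  simp only [op, map_add, map_sub, LinearMap.add_apply, LinearMap.sub_apply, T.τ_mid, T.τ_right,
    T.τ_left, add_zero, sub_zero]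
  abel

theorem isAssociative_q_iff : T.q.IsAssociative ↔ ∀ x y z, T.tauBar x y z = 0 := by
  refine forall_congr' fun x => forall_congr' fun y => forall_congr' fun z => ?_
  change T.op (T.op x y) z = T.op x (T.op y z) ↔ _
  rw [op_op, add_eq_left]

/-- The elementwise criterion never mentions addition, and `A` and `q(A)` share zero and scalars. -/
theorem isCocyclic_q_iff : T.q.IsCocyclic ↔ (Quasimodule.ofModule F A).IsCocyclic := by
  rw [Quasimodule.isCocyclic_iff, Quasimodule.isCocyclic_iff]
  rfl

theorem tauBar_self_left (x y : A) : T.tauBar x x y = 0 := by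
  rw [tauBar, T.self_self, T.swap, zero_add, neg_add_cancel]

theorem tauBar_rotate (x y z : A) : T.tauBar y z x = T.tauBar x y z := by
  simp only [tauBar]
  abel

/-- The map `τ̄` as a linear map in its first variable. -/
def tauBarLinear (y z : A) : A →ₗ[R] A :=
  (T.τ.flip y).flip z + T.τ y z + (T.τ z).flip y

theorem tauBarLinear_apply (x y z : A) : T.tauBarLinear y z x = T.tauBar x y z := rfl

theorem tauBar_eq_zero_of_span {G : Set A} (hG : Submodule.span R G = ⊤)
    (h : ∀ x ∈ G, ∀ y ∈ G, ∀ z ∈ G, T.tauBar x y z = 0) (x y z : A) : T.tauBar x y z = 0 := by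
  have key : ∀ y z, (∀ x ∈ G, T.tauBar x y z = 0) → ∀ x, T.tauBar x y z = 0 := by
    intro y z hx x
    have : T.tauBarLinear y z = 0 := LinearMap.ext_on hG fun x hx' => hx x hx'
    rw [← tauBarLinear_apply, this, LinearMap.zero_apply]
  refine key y z (fun x hx => ?_) x
  rw [← tauBar_rotate]
  refine key z x (fun y hy => ?_) y
  rw [← tauBar_rotate]
  refine key x y (fun z hz => ?_) z
  rw [← tauBar_rotate]
  exact h x hx y hy z hz

/-- Some three members of a minimal generating set have `τ̄ ≠ 0`; being alternating, `τ̄` forces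
them to be distinct. -/
theorem three_le_spanFinrank [Finite A] (h : ∃ x y z, T.tauBar x y z ≠ 0) :
    3 ≤ (⊤ : Submodule R A).spanFinrank := by
  obtain ⟨x, y, z, hne⟩ := h
  obtain ⟨G, hcard, hG⟩ := Submodule.FG.exists_span_finset_card_eq_spanFinrank
    (Module.Finite.fg_top (R := R) (M := A))
  by_contra! hlt
  rw [← hcard] at hlt
  refine hne (T.tauBar_eq_zero_of_span hG (fun a ha b hb c hc => ?_) x y z)
  by_contra habc
  refine hlt.not_ge (Finset.two_lt_card.mpr ⟨a, ha, b, hb, c, hc, ?_, ?_, ?_⟩)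
  · rintro rfl
    exact habc (T.tauBar_self_left _ _)
  · rintro rfl
    exact habc (by rw [← T.tauBar_rotate, ← T.tauBar_rotate, T.tauBar_self_left])
  · rintro rfl
    exact habc (by rw [← T.tauBar_rotate, T.tauBar_self_left])

theorem ker_smul_tauBar {r : R} (hr : r ∈ RingHom.ker F) (x y z : A) :
    r • T.tauBar x y z = 0 := by
  simp only [tauBar, smul_add, T.ker_smul r hr, add_zero]

end TernaryAlgebra

/-! ### Torsion and the main theorem -/

/-- If `I^(n+1)` kills `x`, then `I^n` kills `I x`, so by induction `x` is killed by `I` modulo the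
`n`-th stage. -/
theorem mem_primitiveSeq_of_pow {R : Type u} [CommRing R] (F : R →+* ZMod 3) {M : Type v}
    [AddCommGroup M] [Module R M] (n : ℕ) :
    ∀ x : M, (∀ r ∈ RingHom.ker F ^ n, r • x = 0) → x ∈ primitiveSeq F M (n : Ordinal.{v}) := by
  induction n with
  | zero =>
    intro x hx
    rw [← one_smul R x, hx 1 (by rw [pow_zero, Ideal.one_eq_top]; trivial)]
    exact zero_mem _
  | succ n ih =>
    intro x hx
    rw [Nat.cast_succ, primitiveSeq, Ordinal.limitRecOn_add_one, Submodule.mem_comap, primitivePart,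
      Submodule.mem_torsionBySet_iff]
    rintro ⟨r, hr⟩
    change r • Submodule.mkQ _ x = 0
    rw [← map_smul, Submodule.mkQ_apply, Submodule.Quotient.mk_eq_zero]
    refine ih _ fun a ha => ?_
    rw [← mul_smul]
    exact hx _ (by rw [pow_succ]; exact Ideal.mul_mem_mul ha hr)

/-- A finite cocyclic module with a nonzero element killed by `ker F` is `K̂`-torsion. -/
theorem isKHatTorsion_of_isCocyclic {R : Type u} [CommRing R] [IsNoetherianRing R]
    {F : R →+* ZMod 3} {M : Type v} [AddCommGroup M] [Module R M] [Finite M]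
    (hM : (Quasimodule.ofModule F M).IsCocyclic) {k : M} (hk : k ≠ 0)
    (hIk : ∀ r ∈ RingHom.ker F, r • k = 0) : IsKHatTorsion F M := by
  obtain ⟨s, hs0, hs⟩ := (Quasimodule.isCocyclic_iff _).mp hM
  replace hs : ∀ x : M, x ≠ 0 → ∃ r : R, r • x = s := hs
  have hIs : ∀ r ∈ RingHom.ker F, r • s = 0 := by
    obtain ⟨a, rfl⟩ := hs k hk
    intro r hr
    rw [smul_comm, hIk r hr, smul_zero]
  -- By finiteness `r^m x = r^(m+d+1) x` for some `m`, `d`. If this is nonzero, `s` is a multiple of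
  -- it, hence a multiple of `r s = 0`.
  have hnil : ∀ r ∈ RingHom.ker F, ∀ x : M, ∃ n : ℕ, r ^ n • x = 0 := by
    intro r hr x
    obtain ⟨m, n, hmn, h⟩ := Finite.exists_ne_map_eq_of_infinite fun n : ℕ => r ^ n • x
    wlog hlt : m < n generalizing m n
    · exact this n m hmn.symm h.symm (by omega)
    obtain ⟨d, rfl⟩ := Nat.exists_eq_add_of_lt hlt
    refine ⟨m, by_contra fun hne => hs0 ?_⟩
    obtain ⟨a, ha⟩ := hs _ hne
    rw [← ha]
    change a • r ^ m • x = 0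
    have h' : r ^ m • x = r ^ d • r • r ^ m • x := by
      rw [← mul_smul, ← mul_smul, ← pow_succ, ← pow_add]
      refine Eq.trans h ?_
      congr 2
      omega
    rw [h', smul_comm a, smul_comm a, ha, hIs r hr, smul_zero]
  -- Finiteness of `M` makes the exponent uniform in `x`; finite generation of `I` then yields one
  -- power of `I` annihilating `M`.
  have hrad : RingHom.ker F ≤ (Module.annihilator R M).radical := by
    intro r hr
    choose n hn using hnil r hr
    obtain ⟨N, hN⟩ := (Set.finite_range n).bddAbove
    refine ⟨N, Module.mem_annihilator.mpr fun x => ?_⟩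
    rw [← Nat.sub_add_cancel (hN ⟨x, rfl⟩), pow_add, mul_smul, hn, smul_zero]
  obtain ⟨N, hN⟩ := Ideal.exists_pow_le_of_le_radical_of_fg hrad
    (IsNoetherian.noetherian (RingHom.ker F))
  refine eq_top_iff.mpr fun x _ => ?_
  exact le_iSup (primitiveSeq F M) (N : Ordinal.{v})
    (mem_primitiveSeq_of_pow F N x fun r hr => Module.mem_annihilator.mp (hN hr) x)

theorem mainTheorem4 {R : Type u} [CommRing R] [IsNoetherianRing R]
    (F : R →+* ZMod 3) (hF : Function.Surjective F)
    {Q : Type v} [Finite Q] (X : Quasimodule F Q) :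
    ((¬ X.IsAssociative ∧ X.IsCocyclic) ↔
      ∃ (_ : AddCommGroup Q) (_ : Module R Q) (T : TernaryAlgebra F Q),
        X = T.q ∧ (∃ x y z : Q, T.tauBar x y z ≠ 0) ∧
          (Quasimodule.ofModule F Q).IsCocyclic) ∧
    (∀ (_ : AddCommGroup Q) (_ : Module R Q) (T : TernaryAlgebra F Q),
      X = T.q → (∃ x y z : Q, T.tauBar x y z ≠ 0) →
        (Quasimodule.ofModule F Q).IsCocyclic →
          IsKHatTorsion F Q ∧ 3 ≤ (⊤ : Submodule R Q).spanFinrank) := by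
  refine ⟨⟨fun ⟨hna, hX⟩ => ?_, ?_⟩, ?_⟩
  · obtain ⟨C, ⟨t⟩⟩ := Quasimodule.exists_associatorSplitting hna hX
    let := t.addCommGroup
    let := t.module
    have hq : X = t.ternaryAlgebra.q := t.eq_q
    refine ⟨t.addCommGroup, t.module, t.ternaryAlgebra, hq, ?_, ?_⟩
    · rw [hq, TernaryAlgebra.isAssociative_q_iff] at hna
      push Not at hna
      exact hna
    · rw [hq] at hX
      exact t.ternaryAlgebra.isCocyclic_q_iff.mp hX
  · rintro ⟨_, _, T, rfl, ⟨x, y, z, hne⟩, hc⟩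
    exact ⟨fun h => hne (T.isAssociative_q_iff.mp h x y z), T.isCocyclic_q_iff.mpr hc⟩
  · rintro _ _ T - ⟨x, y, z, hne⟩ hc
    -- The nonzero element killed by `I` is `τ̄ (x, y, z)` itself.
    exact ⟨isKHatTorsion_of_isCocyclic hc hne fun r hr => T.ker_smul_tauBar hr x y z,
      T.three_le_spanFinrank ⟨x, y, z, hne⟩⟩
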